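/- **Graphs.** A graph has finitely many vertices, internal edges (each with two ends, both attached to vertices; multiple edges and self-loops are allowed), and $n$ external edges, each attached to one vertex, whose free ends carry pairwise distinct labels $1,\dots,n$. Its loop number is the number of its independent cycles. An ordered graph is a graph whose vertices and whose ends of internal edges are numbered. The symmetry factor $S^\gamma$ of $\gamma$ is the number of pairs consisting of a permutation of the numbering of the vertices and a permutation of the numbering of the ends of internal edges that together give back the same ordered labeled graph. **Algebra.** Let $V$ be a complex vector space, $\mathsf S(V)$ its symmetric algebra, with the coproduct $\Delta$ for which the elements of $V$ are primitive, and let $K\in V\otimes V$ be a symmetric tensor (the inverse propagator). For $1\le i,j\le v$ let $R_{i,j}\in\mathsf S(V)^{\otimes v}$ be the image of $K$ under the linear map that sends $x\otimes y$ to the product of $x$ placed in the $i$-th tensor factor and $y$ placed in the $j$-th. Put $T_i=\tfrac12R_{i,i}:\mathsf S(V)^{\otimes v}\to\mathsf S(V)^{\otimes v}$ and $Q_i=\tfrac12R_{i,i+1}\circ\Delta_i:\mathsf S(V)^{\otimes v}\to\mathsf S(V)^{\otimes (v+1)}$, where $R_{i,j}$ acts by multiplication and $\Delta_i$ applies $\Delta$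 to the $i$-th factor. Define $\Omega^{l,v}:\mathsf S(V)\to\mathsf S(V)^{\otimes v}$ for $l\ge0$, $v\ge1$ by $\Omega^{0,1}=\mathrm{id}$ and, for $(l,v)\ne(0,1)$, $$\Omega^{l,v}=\frac1{l+v-1}\Big(\sum_{i=1}^{v-1}Q_i\circ\Omega^{l,v-1}+\sum_{i=1}^{v}T_i\circ\Omega^{l-1,v}\Big),$$ where the first sum is absent for $v=1$ and the second for $l=0$. Given $\phi(x_1),\dots,\phi(x_n)\in V$, an ordered graph $\gamma$ with $v$ vertices and $n$ external edges represents the element $[\gamma]\in\mathsf S(V)^{\otimes v}$ that is the product of one factor $R_{i,j}$ for each internal edge joining vertices $i$ and $j$ (possibly $i=j$) and, for each $k$, of $\phi(x_k)$ placed in the $i$-th tensor factor, where $i$ is the vertex carrying the $k$-th external edge. **Theorem 1.** Let $l,n\ge0$ and $v\ge1$ be integers. There are rational weights $w_\gamma$, depending only on $l,v,n$ and the ordered graph $\gamma$, with $w_\gamma\neq0$ for only finitely many $\gamma$, all of them connected with $l$ loops, $v$ vertices and $n$ external edges labeled $1,\dots,n$, such that for all $V$, $K$ and $\phi(x_1),\dots,\phi(x_n)\in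 V$ $$\Omega^{l,v}(\phi(x_1)\cdots\phi(x_n))=\sum_\gamma w_\gamma\,[\gamma]\in\mathsf S(V)^{\otimes v},$$ and such that every (unordered) connected graph with $l$ loops, $v$ vertices and $n$ external edges labeled $1,\dots,n$ has total weight $1/S^\gamma$, where the total weight of an unordered graph is the sum of the weights of all ordered graphs that coincide with it when the orderings are forgotten. The same identity, with the same weights, holds when the $R_{i,j}$ only exist in a completion of $\mathsf S(V)^{\otimes v}$: let $W$ be a complex vector space (of classical fields) with a symmetric bilinear form $B$, let $\phi(x_k)$ be linear functionals on $W$, replace $\mathsf S(V)^{\otimes v}$ by the algebra of functions $F:W^v\to\mathbb C$ (and the domain $\mathsf S(V)$ of $\Omega^{l,v}$ by the functions $W\to\mathbb C$), let $\phi(x_k)$ placed in the $i$-th factor be the function $\phi(x_k)(f_i)$, let $R_{i,j}$ be the function $B(f_i,f_j)$, and let $(\Delta_iF)(f_1,\dots,f_{v+1})=F(f_1,\dots,f_i+f_{i+1},\dots,f_{v+1})$. -/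

import Mathlib

open scoped TensorProduct

noncomputable section

namespace Feynman

/-! ### Graphs -/

/-- An ordered graph with `v` vertices and `n` labelled external edges. The internal edges are
numbered by `Fin e`, and the two ends of the internal edge `k` are `(k, false)` and `(k, true)`;
`att h` is the vertex to which the end `h` is connected (multiple edges and self-loops are
allowed). The external edge whose free end carries the `k`-th label is connected to the vertex
`leg k`. (An external edge with two free ends is a whole connected component without a vertex,
so it does not occur in a connected graph with at least one vertex.) -/
structure OrderedGraph (v n : ℕ) where
  /-- the number of internal edges -/
  e : ℕ
  /-- the vertex to which an end of an internal edge is connected -/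
  att : Fin e × Bool → Fin v
  /-- the vertex to which an external edge is connected -/
  leg : Fin n → Fin v

namespace OrderedGraph

variable {v n : ℕ}

/-- The other end of the same internal edge. -/
def mate {e : ℕ} (h : Fin e × Bool) : Fin e × Bool := (h.1, !h.2)

/-- Two different vertices are adjacent if an internal edge joins them. -/
def toSimpleGraph (γ : OrderedGraph v n) : SimpleGraph (Fin v) :=
  SimpleGraph.fromRel fun i j => ∃ h : Fin γ.e × Bool, γ.att h = i ∧ γ.att (mate h) = j

/-- A graph is connected if any two vertices are joined by a path of internal edges
(and there is at least one vertex). -/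
def Connected (γ : OrderedGraph v n) : Prop := γ.toSimpleGraph.Connected

/-- The boundary map from chains of internal edges to chains of vertices, with the internal edge
`k` oriented from `(k, false)` to `(k, true)`. -/
def boundary (γ : OrderedGraph v n) : (Fin γ.e → ℚ) →ₗ[ℚ] (Fin v → ℚ) :=
  ∑ k : Fin γ.e, (LinearMap.proj k : (Fin γ.e → ℚ) →ₗ[ℚ] ℚ).smulRight
    (Pi.single (γ.att (k, true)) 1 - Pi.single (γ.att (k, false)) 1)

/-- The loop number of a graph: the number of its independent cycles, that is, the dimension of
the cycle space. -/
def loopNumber (γ : OrderedGraph v n) : ℕ := Module.finrank ℚ (LinearMap.ker γ.boundary)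

/-- A renumbering of the vertices and of the ends of the internal edges of `γ` which turns it into
`γ'`: it matches the two ends of an edge with the two ends of an edge and respects the attachment
of all edges to the vertices, every label staying where it is. -/
@[ext]
structure Iso (γ γ' : OrderedGraph v n) where
  /-- the renumbering of the vertices -/
  vert : Equiv.Perm (Fin v)
  /-- the renumbering of the ends of the internal edges -/
  ends : Fin γ.e × Bool ≃ Fin γ'.e × Bool
  ends_mate : ∀ h, ends (mate h) = mate (ends h)
  att_ends : ∀ h, γ'.att (ends h) = vert (γ.att h)
  leg_eq : ∀ k, γ'.leg k = vert (γ.leg k)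

/-- The symmetry factor of a graph: the number of permutations of the numbering of the vertices
and of the ends of the internal edges which yield the same ordered labelled graph. -/
def symmetryFactor (γ : OrderedGraph v n) : ℕ := Nat.card (Iso γ γ)

open scoped Classical in
/-- In a formal linear combination `w` of ordered graphs, the weight of the unordered graph that
underlies `γ`: the sum of the weights of all ordered graphs which coincide with `γ` once the
orderings are forgotten. -/
def unorderedWeight (w : OrderedGraph v n →₀ ℚ) (γ : OrderedGraph v n) : ℚ :=
  ∑ γ' ∈ w.support with Nonempty (Iso γ' γ), w γ'

end OrderedGraph

/-! ### The recursion -/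

/-- The recursion `Ω^{0,1} = id`,
`Ω^{l,v} = (l + v - 1)⁻¹ (∑ i, Q_i ∘ Ω^{l,v-1} + ∑ i, T_i ∘ Ω^{l-1,v})`, where the sum over the
`Q_i` is absent for `v = 1` and the sum over the `T_i` is absent for `l = 0`. It only concerns
`v ≥ 1`; the value at `v = 0` is `0` by convention. -/
def omegaRec {𝕜 S : Type*} {M : ℕ → Type*} [Field 𝕜] [AddCommGroup S] [Module 𝕜 S]
    [∀ v, AddCommGroup (M v)] [∀ v, Module 𝕜 (M v)] (id₁ : S →ₗ[𝕜] M 1)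
    (T : ∀ v, Fin v → (M v →ₗ[𝕜] M v)) (Q : ∀ v, Fin v → (M v →ₗ[𝕜] M (v + 1))) :
    ℕ → ∀ v : ℕ, S →ₗ[𝕜] M v
  | _, 0 => 0
  | 0, 1 => id₁
  | 0, v + 2 => ((v : 𝕜) + 1)⁻¹ •
      ∑ i : Fin (v + 1), Q (v + 1) i ∘ₗ omegaRec id₁ T Q 0 (v + 1)
  | l + 1, v + 1 => ((l : 𝕜) + v + 1)⁻¹ •
      (∑ i : Fin v, Q v i ∘ₗ omegaRec id₁ T Q (l + 1) v +
        ∑ i : Fin (v + 1), T (v + 1) i ∘ₗ omegaRec id₁ T Q l (v + 1))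
termination_by l v => (l, v)

/-! ### Tensor powers of the symmetric algebra -/

section Tensor

variable {V : Type*} [AddCommGroup V] [Module ℂ V]

variable (V) in
/-- `S(V)^{⊗ v}`. -/
def TensorPow (v : ℕ) : Type _ := ⨂[ℂ] _ : Fin v, SymmetricAlgebra ℂ V

/-- The componentwise product on `S(V)^{⊗ v}`. -/
instance instCommRingTensorPow (v : ℕ) : CommRing (TensorPow V v) :=
  inferInstanceAs (CommRing (⨂[ℂ] _ : Fin v, SymmetricAlgebra ℂ V))

instance instAlgebraTensorPow (v : ℕ) : Algebra ℂ (TensorPow V v) :=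
  inferInstanceAs (Algebra ℂ (⨂[ℂ] _ : Fin v, SymmetricAlgebra ℂ V))

/-- `1 ⊗ ⋯ ⊗ a ⊗ ⋯ ⊗ 1` with `a` at position `i`. -/
def place {v : ℕ} (i : Fin v) : SymmetricAlgebra ℂ V →ₐ[ℂ] TensorPow V v :=
  PiTensorProduct.singleAlgHom (A := fun _ : Fin v => SymmetricAlgebra ℂ V) i

/-- The field operator `x` at position `i`. -/
def fieldAt {v : ℕ} (i : Fin v) (x : V) : TensorPow V v := place i (SymmetricAlgebra.ι ℂ V x)

/-- The internal edge `R_{i,j}`: the linear image of the inverse propagator `K ∈ V ⊗ V` under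
`x ⊗ y ↦ (x at position i) * (y at position j)`. -/
def edge (K : V ⊗[ℂ] V) {v : ℕ} (i j : Fin v) : TensorPow V v :=
  LinearMap.mul' ℂ (TensorPow V v)
    (TensorProduct.map ((place i).toLinearMap ∘ₗ SymmetricAlgebra.ι ℂ V)
      ((place j).toLinearMap ∘ₗ SymmetricAlgebra.ι ℂ V) K)

/-- Where `Δ_i` sends the component `j`: the component `i` is split by the coproduct `Δ` of `S(V)`
and the two halves are put into the positions `i` and `i + 1`, the components before it keep their
positions, and the components after it move up by one. -/
def comulComponent {v : ℕ} (i j : Fin v) : SymmetricAlgebra ℂ V →ₐ[ℂ] TensorPow V (v + 1) :=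
  if j < i then place j.castSucc
  else if j = i then
    (Algebra.TensorProduct.productMap (place i.castSucc) (place i.succ)).comp
      (Bialgebra.comulAlgHom ℂ (SymmetricAlgebra ℂ V))
  else place j.succ

/-- `Δ_i = id ⊗ ⋯ ⊗ Δ ⊗ ⋯ ⊗ id`, with the coproduct `Δ` of `S(V)` applied to the component `i`. -/
def comulAt {v : ℕ} (i : Fin v) : TensorPow V v →ₐ[ℂ] TensorPow V (v + 1) :=
  PiTensorProduct.liftAlgHom (A := fun _ : Fin v => SymmetricAlgebra ℂ V)
    ((MultilinearMap.mkPiAlgebra ℂ (Fin v) (TensorPow V (v + 1))).compLinearMap fun j =>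
      (comulComponent i j).toLinearMap)
    (by simp) (by simp [Finset.prod_mul_distrib])

/-- `T_i = ½ R_{i,i}`. -/
def opT (K : V ⊗[ℂ] V) (v : ℕ) (i : Fin v) : TensorPow V v →ₗ[ℂ] TensorPow V v :=
  (2 : ℂ)⁻¹ • LinearMap.mulLeft ℂ (edge K i i)

/-- `Q_i = ½ R_{i,i+1} ∘ Δ_i`. -/
def opQ (K : V ⊗[ℂ] V) (v : ℕ) (i : Fin v) : TensorPow V v →ₗ[ℂ] TensorPow V (v + 1) :=
  (2 : ℂ)⁻¹ • (LinearMap.mulLeft ℂ (edge K i.castSucc i.succ) ∘ₗ (comulAt i).toLinearMap)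

/-- The maps `Ω^{l,v} : S(V) → S(V)^{⊗ v}`. -/
def Omega (K : V ⊗[ℂ] V) (l v : ℕ) : SymmetricAlgebra ℂ V →ₗ[ℂ] TensorPow V v :=
  omegaRec (place (0 : Fin 1)).toLinearMap (opT K) (opQ K) l v

/-- The element of `S(V)^{⊗ v}` represented by an ordered graph whose external edges are labelled
by the field operators `φ 0, …, φ (n - 1)`. -/
def graphElement (K : V ⊗[ℂ] V) {v n : ℕ} (φ : Fin n → V) (γ : OrderedGraph v n) :
    TensorPow V v :=
  (∏ k : Fin γ.e, edge K (γ.att (k, false)) (γ.att (k, true))) *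
    ∏ k : Fin n, fieldAt (γ.leg k) (φ k)

end Tensor

/-! ### The completed version

If the inverse propagator is not an element of the algebraic tensor product `V ⊗ V`, then the
`R_{i,j}` live in a completion of `S(V)^{⊗ v}`. Here the field operators are linear functionals on
a space `W` of classical fields, the elements of `S(V)^{⊗ v}` are polynomial functions of `v`
fields, and the completion is the algebra of all functions `W^v → ℂ`. The product is pointwise and
the coproduct is `(Δ F) (f, g) = F (f + g)`. The inverse propagator is any symmetric bilinear form
`B` on `W`; for a kernel `G`, it is `B f g = ∬ G(x, y) f(x) g(y) dx dy`, so that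
`R_{i,j} = ∬ G(x, y) φ_i(x) φ_j(y) dx dy` is the function `(f_1, …, f_v) ↦ B f_i f_j`. -/

section Completed

variable {W : Type*} [AddCommGroup W] [Module ℂ W]

variable (W) in
/-- The functions of `v` fields. -/
abbrev FieldFunc (v : ℕ) : Type _ := (Fin v → W) → ℂ

/-- Adding up the fields at the positions `i` and `i + 1`. -/
def mergeAt {v : ℕ} (i : Fin v) (f : Fin (v + 1) → W) : Fin v → W := fun j =>
  if j < i then f j.castSucc
  else if j = i then f i.castSucc + f i.succ
  else f j.succ

/-- The internal edge `R_{i,j}` as a function of the fields. -/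
def edgeFunc (B : LinearMap.BilinForm ℂ W) {v : ℕ} (i j : Fin v) : FieldFunc W v :=
  fun f => B (f i) (f j)

/-- `Δ_i` on functions of `v` fields. -/
def comulAtFunc {v : ℕ} (i : Fin v) : FieldFunc W v →ₗ[ℂ] FieldFunc W (v + 1) :=
  LinearMap.funLeft ℂ ℂ (mergeAt i)

/-- `T_i = ½ R_{i,i}`. -/
def opTFunc (B : LinearMap.BilinForm ℂ W) (v : ℕ) (i : Fin v) :
    FieldFunc W v →ₗ[ℂ] FieldFunc W v :=
  (2 : ℂ)⁻¹ • LinearMap.mulLeft ℂ (edgeFunc B i i)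

/-- `Q_i = ½ R_{i,i+1} ∘ Δ_i`. -/
def opQFunc (B : LinearMap.BilinForm ℂ W) (v : ℕ) (i : Fin v) :
    FieldFunc W v →ₗ[ℂ] FieldFunc W (v + 1) :=
  (2 : ℂ)⁻¹ • (LinearMap.mulLeft ℂ (edgeFunc B i.castSucc i.succ) ∘ₗ comulAtFunc i)

/-- The maps `Ω^{l,v}` from functions of one field to functions of `v` fields. -/
def OmegaFunc (B : LinearMap.BilinForm ℂ W) (l v : ℕ) : (W → ℂ) →ₗ[ℂ] FieldFunc W v :=
  omegaRec (LinearMap.funLeft ℂ ℂ fun f : Fin 1 → W => f 0) (opTFunc B) (opQFunc B) l v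

/-- The function of `v` fields represented by an ordered graph whose external edges are labelled
by the functionals `φ 0, …, φ (n - 1)`. -/
def graphFunc (B : LinearMap.BilinForm ℂ W) {v n : ℕ} (φ : Fin n → Module.Dual ℂ W)
    (γ : OrderedGraph v n) : FieldFunc W v := fun f =>
  (∏ k : Fin γ.e, B (f (γ.att (k, false))) (f (γ.att (k, true)))) *
    ∏ k : Fin n, φ k (f (γ.leg k))

end Completed

end Feynman

end

noncomputable section

namespace Feynman

/-! ### Sequences of edges which contract consecutively -/

/-! Put `e = l + v - 1`, the number of internal edges by Euler's formula. Unfolding the recursion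
builds a graph edge by edge. `T_i` adds a loop; `Q_i` splits the vertex `i` into `i` and `i + 1`,
distributes everything attached to it over the two in all ways, and joins them by a new edge. Read
backwards, this deletes a loop or contracts an edge from `i` to `i + 1`. So the result is a sum over
all sequences of `e` oriented edges that `Contracts` down to one vertex, with the external edges
attached in all ways. Each step contributes a factor `1/2` and the reciprocal of the current number
of edges, so all sequences carry the same weight `1 / (e! 2 ^ e)` (`contractSum_succ`,
`omegaRec_apply`). Only the rule by which the coproducts act on edges and external fields enters, so
the tensor version and the function version share one proof and the same weights.

It remains to count the sequences that give a fixed connected graph `γ`. For each of the `e! 2 ^ e`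
ways to order and orient its edges, exactly one numbering of the vertices makes the sequence
contract (`EdgeConnected.existsUnique_contracts`): contract the first edge, number the rest
inductively, and give the ends of that edge the two numbers split off from the merged vertex. Hence
`e! 2 ^ e` renumberings of `γ` contract, and each resulting ordered graph comes from `S^γ` of them.
There are thus `e! 2 ^ e / S^γ` such ordered graphs, of total weight `1 / S^γ`. -/

/-- Moving the ends of all edges along a map of vertices. -/
def mapEnds {e v u : ℕ} (f : Fin v → Fin u) (s : Fin e → Fin v × Fin v) : Fin e → Fin u × Fin u :=
  fun k => (f (s k).1, f (s k).2)

/-- The sequence of edges can be reduced to a single vertex by processing the edges in turn, where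
each edge is either a self-loop, which is deleted, or runs from a vertex to the next one, in which
case it is contracted. -/
def Contracts : ∀ (e v : ℕ), (Fin e → Fin v × Fin v) → Prop
  | 0, v, _ => v = 1
  | _ + 1, 0, _ => False
  | e + 1, u + 1, s =>
      ((s 0).1 = (s 0).2 ∧ Contracts e (u + 1) (Fin.tail s)) ∨
        ∃ i : Fin u, s 0 = (i.castSucc, i.succ) ∧
          Contracts e u (mapEnds i.predAbove (Fin.tail s))

/-- Every predicate on the vertices that is constant along edges is constant, and there is a
vertex. -/
def EdgeConnected {e v : ℕ} (s : Fin e → Fin v × Fin v) : Prop :=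
  0 < v ∧ ∀ f : Fin v → Prop, (∀ k, f (s k).1 ↔ f (s k).2) → ∀ x y, f x ↔ f y

variable {e v : ℕ}

theorem EdgeConnected.apply_eq {s : Fin e → Fin v × Fin v} (hs : EdgeConnected s) {α : Type*}
    (f : Fin v → α) (hf : ∀ k, f (s k).1 = f (s k).2) (x y : Fin v) : f x = f y :=
  (hs.2 (fun z => f z = f y) (fun k => by rw [hf k]) x y).2 rfl

theorem EdgeConnected.mapEnds {u : ℕ} {s : Fin e → Fin v × Fin v} (hs : EdgeConnected s)
    {c : Fin v → Fin u} (hc : Function.Surjective c) : EdgeConnected (mapEnds c s) := by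
  refine ⟨Fin.pos (c ⟨0, hs.1⟩), fun f hf x y => ?_⟩
  obtain ⟨x, rfl⟩ := hc x
  obtain ⟨y, rfl⟩ := hc y
  exact hs.2 (fun z => f (c z)) hf x y

/-- If the ends of the first edge are identified, then the remaining edges still connect. -/
theorem EdgeConnected.tail {u : ℕ} {s : Fin (e + 1) → Fin v × Fin v} (hs : EdgeConnected s)
    {c : Fin v → Fin u} (hc : Function.Surjective c) (h : c (s 0).1 = c (s 0).2) :
    EdgeConnected (Feynman.mapEnds c (Fin.tail s)) := by
  refine ⟨(hs.mapEnds hc).1, fun f hf => (hs.mapEnds hc).2 f fun k => ?_⟩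
  refine Fin.cases ?_ (fun k => hf k) k
  change f (c _) ↔ f (c _)
  rw [h]

theorem contracts_succ_of_loop {u : ℕ} {s : Fin (e + 1) → Fin (u + 1) × Fin (u + 1)}
    (h : (s 0).1 = (s 0).2) : Contracts (e + 1) (u + 1) s ↔ Contracts e (u + 1) (Fin.tail s) := by
  refine ⟨?_, fun hs => Or.inl ⟨h, hs⟩⟩
  rintro (⟨-, hs⟩ | ⟨i, h0, -⟩)
  · exact hs
  · rw [h0] at h
    exact absurd h Fin.castSucc_lt_succ.ne

/-- Neither deleting a loop nor contracting an edge separates vertices, so connectedness lifts back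
from the single vertex at the end. -/
theorem Contracts.edgeConnected {s : Fin e → Fin v × Fin v} (hs : Contracts e v s) :
    EdgeConnected s := by
  induction e generalizing v with
  | zero =>
    obtain rfl : v = 1 := hs
    exact ⟨one_pos, fun f _ x y => by rw [Subsingleton.elim x y]⟩
  | succ e ih =>
    obtain _ | u := v
    · exact hs.elim
    refine ⟨Nat.succ_pos u, fun f hf => ?_⟩
    obtain ⟨-, h⟩ | ⟨i, h0, h⟩ := hs
    · exact (ih h).2 f fun k => hf k.succ
    · have h0' := hf 0
      rw [h0] at h0'
      -- Since `f` agrees at the two ends of the contracted edge, it factors through the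
      -- contraction.
      have key : ∀ x, f (i.succ.succAbove (i.predAbove x)) ↔ f x := fun x => by
        by_cases hx : x = i.succ
        · subst hx
          simpa using h0'
        · rw [Fin.succ_succAbove_predAbove hx]
      intro x y
      rw [← key x, ← key y]
      exact (ih h).2 (fun z => f (i.succ.succAbove z))
        (fun k => (key _).trans ((hf k.succ).trans (key _).symm)) _ _

/-- Each edge removes at most one vertex, and one vertex is left at the end. In the tree case `l =
0` this kills the loop terms, which the recursion lacks. -/
theorem Contracts.le {s : Fin e → Fin v × Fin v} (hs : Contracts e v s) : v ≤ e + 1 := by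
  induction e generalizing v with
  | zero => exact le_of_eq hs
  | succ e ih =>
    obtain _ | u := v
    · exact hs.elim
    obtain ⟨-, h⟩ | ⟨i, -, h⟩ := hs
    · exact (ih h).trans (Nat.le_succ _)
    · exact Nat.succ_le_succ (ih h)

theorem predAbove_succ_succAbove {u : ℕ} (i j : Fin u) :
    i.predAbove (i.succ.succAbove j) = j :=
  Fin.succAbove_right_injective (Fin.succ_succAbove_predAbove (Fin.succAbove_ne i.succ j))

/-- The numberings of `u + 1` vertices which give consecutive numbers to `a` and `b` correspond to
the numberings of the `u` vertices that are left when `a` and `b` are identified. -/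
theorem existsUnique_perm_contraction {u : ℕ} {a b : Fin (u + 1)} (hab : a ≠ b) :
    ∃ c : Fin (u + 1) → Fin u, Function.Surjective c ∧ c a = c b ∧
      (∀ σ : Equiv.Perm (Fin (u + 1)), ∀ i, σ a = Fin.castSucc i → σ b = Fin.succ i →
        ∃ τ : Equiv.Perm (Fin u), ∀ x, i.predAbove (σ x) = τ (c x)) ∧
      ∀ τ : Equiv.Perm (Fin u), ∃! σ : Equiv.Perm (Fin (u + 1)),
        ∃ i, σ a = Fin.castSucc i ∧ σ b = Fin.succ i ∧ ∀ x, i.predAbove (σ x) = τ (c x) := by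
  obtain ⟨y₀, rfl⟩ := Fin.exists_succAbove_eq hab
  -- With `a = b.succAbove y₀`, the map `c` merges `b` into `a` and numbers the other vertices as if
  -- `b` were removed.
  let c : Fin (u + 1) → Fin u := b.insertNth y₀ id
  have cb : c b = y₀ := by simp [c]
  have cs : ∀ y, c (b.succAbove y) = y := fun y => by simp [c]
  refine ⟨c, fun y => ⟨_, cs y⟩, by rw [cb, cs], fun σ i ha hb => ?_, fun τ => ?_⟩
  -- `i.predAbove` is injective away from `i.succ`, and that number is already taken by `b`.
  · have hinj : Function.Injective fun y => i.predAbove (σ (b.succAbove y)) := fun y y' h => by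
      have hne : ∀ z, σ (b.succAbove z) ≠ i.succ := fun z hz =>
        Fin.succAbove_ne b z (σ.injective (hz.trans hb.symm))
      have := congrArg i.succ.succAbove h
      simp only [Fin.succ_succAbove_predAbove (hne _)] at this
      exact Fin.succAbove_right_injective (σ.injective this)
    refine ⟨Equiv.ofBijective _ (Finite.injective_iff_bijective.1 hinj), fun x => ?_⟩
    refine Fin.succAboveCases b ?_ (fun y => ?_) x
    · rw [hb, cb]
      simp [ha]
    · rw [cs]
      rfl
  -- The number `i` of the merged vertex dictates the numbers of `a` and `b`; all other numbers are
  -- obtained by skipping `i.succ`.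
  · set i := τ y₀ with hi
    let g : Fin (u + 1) → Fin (u + 1) := b.insertNth i.succ fun y => i.succ.succAbove (τ y)
    have gb : g b = i.succ := by simp [g]
    have gs : ∀ y, g (b.succAbove y) = i.succ.succAbove (τ y) := fun y => by simp [g]
    have hinj : Function.Injective g := by
      intro x x'
      refine Fin.succAboveCases b ?_ (fun y => ?_) x <;>
        refine Fin.succAboveCases b ?_ (fun y' => ?_) x'
      · simp
      · rw [gb, gs]
        exact fun h => absurd h.symm (Fin.succAbove_ne _ _)
      · rw [gb, gs]
        exact fun h => absurd h (Fin.succAbove_ne _ _)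
      · rw [gs, gs]
        exact fun h => by rw [τ.injective (Fin.succAbove_right_injective h)]
    refine ⟨Equiv.ofBijective g (Finite.injective_iff_bijective.1 hinj), ⟨i, ?_, ?_, fun x => ?_⟩, ?_⟩
    · change g _ = _
      rw [gs, ← hi, Fin.succAbove_of_castSucc_lt _ _ Fin.castSucc_lt_succ]
    · exact gb
    · change i.predAbove (g x) = _
      refine Fin.succAboveCases b ?_ (fun y => ?_) x
      · rw [gb, cb]
        simp [hi]
      · rw [gs, cs, predAbove_succ_succAbove]
    · rintro σ ⟨j, ha, hb, h⟩
      have hj : j = i := by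
        rw [hi, ← cb, ← h, hb]
        simp
      ext1 x
      change σ x = g x
      refine Fin.succAboveCases b ?_ (fun y => ?_) x
      · rw [gb, hb, hj]
      · have hne : σ (b.succAbove y) ≠ j.succ := fun hz =>
          Fin.succAbove_ne b y (σ.injective (hz.trans hb.symm))
        rw [gs, ← hj, ← Fin.succ_succAbove_predAbove hne, h, cs]

/-- If the edges of a connected graph are ordered and oriented, then there is exactly one numbering
of its vertices for which the sequence of edges contracts consecutively. -/
theorem EdgeConnected.existsUnique_contracts {s : Fin e → Fin v × Fin v} (hs : EdgeConnected s) :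
    ∃! σ : Equiv.Perm (Fin v), Contracts e v (Feynman.mapEnds σ s) := by
  induction e generalizing v with
  | zero =>
    have hv : v = 1 := by
      -- Without edges even the numbering itself is constant, so the first and the last vertex
      -- coincide.
      have h := hs.apply_eq (fun x : Fin v => (x : ℕ)) (fun k => k.elim0) ⟨0, hs.1⟩
        ⟨v - 1, Nat.sub_lt hs.1 one_pos⟩
      have := hs.1
      simp only at h
      omega
    subst hv
    exact ⟨1, rfl, fun σ _ => Subsingleton.elim _ _⟩
  | succ e ih =>
    obtain _ | u := v
    · exact absurd hs.1 (lt_irrefl 0)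
    by_cases hab : (s 0).1 = (s 0).2
    · have key : ∀ σ : Equiv.Perm (Fin (u + 1)), Contracts (e + 1) (u + 1) (Feynman.mapEnds σ s) ↔
          Contracts e (u + 1) (Feynman.mapEnds σ (Fin.tail s)) := fun σ =>
        contracts_succ_of_loop (congrArg σ hab)
      simp only [key]
      exact ih (hs.tail (c := id) Function.surjective_id hab)
    · obtain ⟨c, hc, hcab, h1, h2⟩ := existsUnique_perm_contraction hab
      have key : ∀ σ : Equiv.Perm (Fin (u + 1)), Contracts (e + 1) (u + 1) (Feynman.mapEnds σ s) ↔
          ∃ i : Fin u, σ (s 0).1 = i.castSucc ∧ σ (s 0).2 = i.succ ∧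
            Contracts e u (Feynman.mapEnds (fun x => i.predAbove (σ x)) (Fin.tail s)) := fun σ => by
        constructor
        · rintro (⟨h, -⟩ | ⟨i, h0, h⟩)
          · exact absurd (σ.injective h) hab
          · exact ⟨i, (Prod.ext_iff.1 h0).1, (Prod.ext_iff.1 h0).2, h⟩
        · rintro ⟨i, ha, hb, h⟩
          exact Or.inr ⟨i, Prod.ext ha hb, h⟩
      obtain ⟨τ, hτ, hτ'⟩ := ih (hs.tail hc hcab)
      obtain ⟨σ, ⟨i, ha, hb, hσ⟩, hσ'⟩ := h2 τ
      refine ⟨σ, (key σ).2 ⟨i, ha, hb, ?_⟩, fun σ₁ h => ?_⟩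
      · rw [funext hσ]
        exact hτ
      · obtain ⟨j, ha', hb', h⟩ := (key σ₁).1 h
        obtain ⟨τ₁, hτ₁⟩ := h1 σ₁ j ha' hb'
        rw [funext hτ₁] at h
        -- Any contracting numbering descends to the contracted graph, where uniqueness is known;
        -- its lift is then unique too.
        obtain rfl : τ₁ = τ := hτ' τ₁ h
        exact hσ' σ₁ ⟨j, ha', hb', hτ₁⟩

/-! ### The solution of the recursion -/

open scoped Classical in
/-- The sum, over all sequences of `e` edges on `v` vertices which contract consecutively, of the
products of the factors `R` of the edges. -/
def contractSum {A : Type*} [CommRing A] (e v : ℕ) (R : Fin v → Fin v → A) : A :=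
  ∑ s : Fin e → Fin v × Fin v with Contracts e v s, ∏ k, R (s k).1 (s k).2

open scoped Classical in
theorem contractSum_zero_one {A : Type*} [CommRing A] (R : Fin 1 → Fin 1 → A) :
    contractSum 0 1 R = 1 := by
  rw [contractSum, Finset.filter_true_of_mem (p := Contracts 0 1) fun s _ => rfl]
  simp

open scoped Classical in
theorem contractSum_eq_zero {A : Type*} [CommRing A] {e v : ℕ} (h : e + 1 < v)
    (R : Fin v → Fin v → A) : contractSum e v R = 0 := by
  rw [contractSum, Finset.filter_false_of_mem fun s _ hs => (not_le.2 h) hs.le, Finset.sum_empty]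

theorem ite_exists_eq_sum {ι A : Type*} [Fintype ι] [AddCommMonoid A] {p : ι → Prop}
    [DecidablePred p] [Decidable (∃ i, p i)] (x : A)
    (hp : ∀ i j, p i → p j → i = j) :
    (if ∃ i, p i then x else 0) = ∑ i, if p i then x else 0 := by
  by_cases h : ∃ i, p i
  · obtain ⟨i, hi⟩ := h
    rw [if_pos ⟨i, hi⟩, Finset.sum_eq_single i, if_pos hi]
    · exact fun j _ hj => if_neg fun hj' => hj (hp j i hj' hi)
    · simp
  · rw [if_neg h, Finset.sum_eq_zero]
    exact fun i _ => if_neg fun hi => h ⟨i, hi⟩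

open scoped Classical in
/-- An algebra homomorphism which replaces every factor of an edge by the sum over the liftings of
the edge along `c` does the same with products of such factors. -/
theorem map_prod_edges {A A' F : Type*} [CommRing A] [CommRing A'] [FunLike F A A']
    [RingHomClass F A A'] (D : F) {e v u : ℕ} (c : Fin u → Fin v) (R : Fin v → Fin v → A)
    (R' : Fin u → Fin u → A')
    (hD : ∀ a b, D (R a b) = ∑ p with c p = a, ∑ q with c q = b, R' p q)
    (s : Fin e → Fin v × Fin v) :
    D (∏ k, R (s k).1 (s k).2) =
      ∑ t : Fin e → Fin u × Fin u with mapEnds c t = s, ∏ k, R' (t k).1 (t k).2 := by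
  have h : ∀ x : Fin v × Fin v, D (R x.1 x.2) =
      ∑ y : Fin u × Fin u with (c y.1, c y.2) = x, R' y.1 y.2 := fun x => by
    rw [hD, ← Finset.sum_product']
    refine Finset.sum_congr ?_ fun _ _ => rfl
    ext y
    simp [Prod.ext_iff]
  rw [map_prod]
  simp_rw [h]
  rw [Finset.prod_univ_sum]
  refine Finset.sum_congr ?_ fun _ _ => rfl
  ext t
  simp [funext_iff, mapEnds]

theorem sum_sum_sum_ite_eq {X T ι A : Type*} [Fintype X] [Fintype T] [Fintype ι] [DecidableEq X]
    [AddCommMonoid A] (g : ι → X) (c : ι → T → A) :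
    (∑ x, ∑ t, ∑ i, if x = g i then c i t else 0) = ∑ i, ∑ t, c i t := by
  rw [Finset.sum_comm, Finset.sum_comm' (t' := Finset.univ) (s' := fun _ => Finset.univ) (by simp)]
  rw [Finset.sum_congr rfl fun x _ => Finset.sum_comm, Finset.sum_comm]
  refine Finset.sum_congr rfl fun i _ => ?_
  rw [Finset.sum_comm]
  simp

/-- The first edge of a sequence is the one the recursion adds last: a loop belongs to a `T`, an
edge from `i` to `i + 1` to `Q_i`. In the latter case the other edges range over all lifts, along
`i.predAbove`, of a contracting sequence on `u` vertices, and `D i` produces exactly these lifts. -/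
theorem contractSum_succ {A A' F : Type*} [CommRing A] [CommRing A'] [FunLike F A A']
    [RingHomClass F A A'] {e u : ℕ} (D : Fin u → F) (R : Fin u → Fin u → A)
    (R' : Fin (u + 1) → Fin (u + 1) → A')
    (hD : ∀ i a b, D i (R a b) =
      ∑ p with i.predAbove p = a, ∑ q with i.predAbove q = b, R' p q) :
    contractSum (e + 1) (u + 1) R' = ∑ i : Fin u, R' i.castSucc i.succ * D i (contractSum e u R) +
      ∑ a, R' a a * contractSum e (u + 1) R' := by
  classical
  have hmap : ∀ i, D i (contractSum e u R) =
      ∑ t : Fin e → Fin (u + 1) × Fin (u + 1),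
        if Contracts e u (mapEnds i.predAbove t) then ∏ k, R' (t k).1 (t k).2 else 0 := fun i => by
    rw [contractSum, map_sum]
    simp_rw [map_prod_edges (D i) i.predAbove R R' (hD i)]
    -- Sequences on `u + 1` vertices are grouped by their images under the contraction.
    rw [← Finset.sum_filter, ← Finset.sum_fiberwise_of_maps_to (g := mapEnds i.predAbove)
      (t := Finset.univ.filter (Contracts e u)) (by simp)]
    refine Finset.sum_congr rfl fun s hs => Finset.sum_congr ?_ fun _ _ => rfl
    ext t
    simp only [Finset.mem_filter, Finset.mem_univ, true_and] at hs ⊢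
    exact ⟨fun h => ⟨h ▸ hs, h⟩, fun h => h.2⟩
  rw [contractSum, Finset.sum_filter,
    ← (Fin.consEquiv fun _ => Fin (u + 1) × Fin (u + 1)).sum_comp, Fintype.sum_prod_type]
  -- The alternatives for the first edge exclude each other and the edge determines `i` or `a`, so
  -- the indicator of their disjunction is the sum of the indicators.
  have hsplit : ∀ (x : Fin (u + 1) × Fin (u + 1)) (t : Fin e → Fin (u + 1) × Fin (u + 1)),
      (if Contracts (e + 1) (u + 1) (Fin.cons x t : Fin (e + 1) → Fin (u + 1) × Fin (u + 1)) then
        R' x.1 x.2 * ∏ k, R' (t k).1 (t k).2 else 0) =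
      (∑ i : Fin u, if x = (i.castSucc, i.succ) then R' i.castSucc i.succ *
        (if Contracts e u (mapEnds i.predAbove t) then ∏ k, R' (t k).1 (t k).2 else 0) else 0) +
      ∑ a : Fin (u + 1), if x = (a, a) then R' a a *
        (if Contracts e (u + 1) t then ∏ k, R' (t k).1 (t k).2 else 0) else 0 := fun x t => by
    by_cases hx : x.1 = x.2
    · obtain ⟨a, b⟩ := x
      obtain rfl : a = b := hx
      rw [Finset.sum_eq_zero, zero_add, Finset.sum_eq_single a]
      · simp [contracts_succ_of_loop]
      · intro c _ hc
        exact if_neg fun h => hc (Prod.ext_iff.1 h).1.symm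
      · simp
      · intro i _
        refine if_neg fun h => ?_
        exact Fin.castSucc_lt_succ.ne ((Prod.ext_iff.1 h).1.symm.trans (Prod.ext_iff.1 h).2)
    · rw [Finset.sum_eq_zero (s := Finset.univ (α := Fin (u + 1))), add_zero]
      · rw [Contracts]
        simp only [Fin.cons_zero, hx, false_and, false_or, Fin.tail_cons]
        rw [ite_exists_eq_sum]
        · refine Finset.sum_congr rfl fun i _ => ?_
          by_cases h : x = (i.castSucc, i.succ)
          · subst h
            simp
          · simp [h]
        · rintro i j ⟨h, -⟩ ⟨h', -⟩
          exact Fin.succ_injective _ ((Prod.ext_iff.1 h).2.symm.trans (Prod.ext_iff.1 h').2)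
      · intro a _
        refine if_neg fun h => hx ?_
        rw [h]
  simp only [Fin.consEquiv_apply, Fin.prod_univ_succ, Fin.cons_zero, Fin.cons_succ]
  refine (Finset.sum_congr rfl fun x _ => Finset.sum_congr rfl fun t _ => hsplit x t).trans ?_
  simp_rw [Finset.sum_add_distrib]
  rw [sum_sum_sum_ite_eq, sum_sum_sum_ite_eq]
  simp_rw [hmap, contractSum, Finset.sum_filter, Finset.mul_sum]

open scoped Nat in
/-- The recursion is solved by the sum over all sequences of edges which contract consecutively,
multiplied by a factor `X` which is compatible with the coproducts. -/
theorem omegaRec_apply {S : Type*} {M : ℕ → Type*} [AddCommGroup S] [Module ℂ S]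
    [∀ v, CommRing (M v)] [∀ v, Algebra ℂ (M v)] {id₁ : S →ₗ[ℂ] M 1}
    {T : ∀ v, Fin v → (M v →ₗ[ℂ] M v)} {Q : ∀ v, Fin v → (M v →ₗ[ℂ] M (v + 1))}
    (R : ∀ v, Fin v → Fin v → M v) (X : ∀ v, M v) (D : ∀ v, Fin v → M v →ₐ[ℂ] M (v + 1))
    (hT : ∀ v i m, T v i m = (2 : ℂ)⁻¹ • (R v i i * m))
    (hQ : ∀ v i m, Q v i m = (2 : ℂ)⁻¹ • (R (v + 1) i.castSucc i.succ * D v i m))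
    (hDR : ∀ v i a b, D v i (R v a b) =
      ∑ p with i.predAbove p = a, ∑ q with i.predAbove q = b, R (v + 1) p q)
    (hDX : ∀ v i, D v i (X v) = X (v + 1)) {m : S} (hm : id₁ m = X 1) (e l v : ℕ)
    (hv : 0 < v) (h : e + 1 = l + v) :
    omegaRec id₁ T Q l v m = ((e ! : ℂ) * 2 ^ e)⁻¹ • (contractSum e v (R v) * X v) := by
  induction e generalizing l v with
  | zero =>
    obtain rfl : v = 1 := by omega
    obtain rfl : l = 0 := by omega
    simp [omegaRec, hm, contractSum_zero_one]
  | succ e ih =>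
    obtain ⟨u, rfl⟩ : ∃ u, v = u + 1 := ⟨v - 1, by omega⟩
    -- The factor `(e + 1)⁻¹` is the prefactor of the recursion, and `2⁻¹` comes from `T` or `Q`.
    have hc : (((e + 1)! : ℂ) * 2 ^ (e + 1))⁻¹ =
        ((e : ℂ) + 1)⁻¹ * (2⁻¹ * ((e ! : ℂ) * 2 ^ e)⁻¹) := by
      rw [Nat.factorial_succ]
      push_cast
      rw [pow_succ, ← mul_inv, ← mul_inv]
      ring_nf
    have hQsum : ∀ l', e + 1 = l' + u → ∑ i : Fin u, Q u i (omegaRec id₁ T Q l' u m) =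
        (2⁻¹ * ((e ! : ℂ) * 2 ^ e)⁻¹) • ((∑ i : Fin u, R (u + 1) i.castSucc i.succ *
          D u i (contractSum e u (R u))) * X (u + 1)) := fun l' hl' => by
      rw [Finset.sum_mul, Finset.smul_sum]
      refine Finset.sum_congr rfl fun i _ => ?_
      rw [ih l' u i.pos hl', hQ, map_smul, map_mul, hDX, mul_smul_comm, smul_smul, mul_assoc]
    have hTsum : ∀ l', e + 1 = l' + (u + 1) →
        ∑ i : Fin (u + 1), T (u + 1) i (omegaRec id₁ T Q l' (u + 1) m) =
        (2⁻¹ * ((e ! : ℂ) * 2 ^ e)⁻¹) • ((∑ i : Fin (u + 1), R (u + 1) i i *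
          contractSum e (u + 1) (R (u + 1))) * X (u + 1)) := fun l' hl' => by
      rw [Finset.sum_mul, Finset.smul_sum]
      refine Finset.sum_congr rfl fun i _ => ?_
      rw [ih l' (u + 1) hv hl', hT, mul_smul_comm, smul_smul, mul_assoc]
    rw [contractSum_succ (D u) (R u) (R (u + 1)) (hDR u), hc, mul_smul, add_mul, smul_add]
    obtain _ | l := l
    · obtain ⟨u, rfl⟩ : ∃ u', u = u' + 1 := ⟨u - 1, by omega⟩
      obtain rfl : e = u := by omega
      -- The recursion has no `T` terms for `l = 0`; correspondingly, `e` edges cannot contract `e +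
      -- 2` vertices.
      rw [contractSum_eq_zero (by omega : e + 1 < e + 1 + 1)]
      simp only [mul_zero, Finset.sum_const_zero, zero_mul, smul_zero, add_zero]
      rw [← hQsum 0 (by omega), omegaRec]
      simp
    · rw [← hQsum (l + 1) (by omega), ← hTsum l (by omega), omegaRec]
      have he : (e : ℂ) = l + u := by
        rw [← Nat.cast_add]
        congr 1
        omega
      simp [he]

/-! ### Coproducts as sums over the fibres of a contraction -/

theorem filter_predAbove_eq {v : ℕ} (i j : Fin v) :
    (Finset.univ.filter fun p : Fin (v + 1) => i.predAbove p = j) =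
      if j < i then {j.castSucc} else if j = i then {i.castSucc, i.succ} else {j.succ} := by
  ext p
  have h : ((i.predAbove p : Fin v) : ℕ) = if (i : ℕ) < p then (p : ℕ) - 1 else p := by
    rw [Fin.predAbove]
    split_ifs with h1 h2 h2 <;> simp only [Fin.lt_def, Fin.val_castSucc] at h1 <;> simp <;> omega
  split_ifs with h1 h2 <;>
    simp only [Finset.mem_filter, Finset.mem_univ, true_and, Finset.mem_singleton,
      Finset.mem_insert, Fin.ext_iff, h, Fin.lt_def, Fin.val_castSucc, Fin.val_succ] at * <;>
    split_ifs <;> omega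

theorem sum_filter_predAbove {v : ℕ} {A : Type*} [AddCommMonoid A] (i j : Fin v)
    (f : Fin (v + 1) → A) :
    (∑ p with i.predAbove p = j, f p) =
      if j < i then f j.castSucc else if j = i then f i.castSucc + f i.succ else f j.succ := by
  rw [filter_predAbove_eq]
  split_ifs
  · simp
  · rw [Finset.sum_pair Fin.castSucc_lt_succ.ne]
  · simp

/-- The product of field operators, each placed at all positions in turn, is compatible with the
coproducts. -/
theorem map_prod_sum_fields {A A' F : Type*} [CommRing A] [CommRing A'] [FunLike F A A']
    [RingHomClass F A A'] {v n : ℕ} (i : Fin v) (D : F) (x : Fin n → Fin v → A)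
    (x' : Fin n → Fin (v + 1) → A')
    (hD : ∀ k j, D (x k j) = ∑ p with i.predAbove p = j, x' k p) :
    D (∏ k, ∑ j, x k j) = ∏ k, ∑ p, x' k p := by
  rw [map_prod]
  refine Finset.prod_congr rfl fun k _ => ?_
  rw [map_sum, Finset.sum_congr rfl fun j _ => hD k j, Finset.sum_fiberwise]

/-! ### The recursion in tensor powers of the symmetric algebra -/

section Tensor

variable {V : Type*} [AddCommGroup V] [Module ℂ V] {v : ℕ}

theorem comulAt_place (i j : Fin v) (a : SymmetricAlgebra ℂ V) :
    comulAt i (place j a) = comulComponent i j a := by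
  change PiTensorProduct.lift _ (PiTensorProduct.tprod ℂ (Pi.mulSingle
    (M := fun _ : Fin v => SymmetricAlgebra ℂ V) j a)) = _
  rw [PiTensorProduct.lift.tprod]
  simp only [MultilinearMap.compLinearMap_apply, MultilinearMap.mkPiAlgebra_apply,
    AlgHom.toLinearMap_apply]
  rw [Finset.prod_eq_single j]
  · simp
  · intro b _ hb
    simp [Pi.mulSingle_eq_of_ne hb]
  · simp

/-- Elements of `V` are primitive: at position `i` the two summands of the coproduct are the two
points of the fibre. -/
theorem comulAt_fieldAt (i j : Fin v) (x : V) :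
    comulAt i (fieldAt j x) = ∑ p with i.predAbove p = j, fieldAt p x := by
  rw [fieldAt, comulAt_place, sum_filter_predAbove, comulComponent]
  split_ifs
  · rfl
  · simp [fieldAt]
  · rfl

/-- Both sides are additive in `K`, and for a pure tensor an edge is a product of two field
operators. -/
theorem comulAt_edge (K : V ⊗[ℂ] V) (i a b : Fin v) :
    comulAt i (edge K a b) =
      ∑ p with i.predAbove p = a, ∑ q with i.predAbove q = b, edge K p q := by
  induction K with
  | zero => simp [edge]
  | add K K' h h' =>
    have hadd : ∀ (u : ℕ) (p q : Fin u), edge (K + K') p q = edge K p q + edge K' p q := by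
      simp [edge]
    simp only [hadd, map_add, h, h', Finset.sum_add_distrib]
  | tmul x y =>
    have htmul : ∀ (u : ℕ) (p q : Fin u), edge (x ⊗ₜ[ℂ] y) p q = fieldAt p x * fieldAt q y :=
      fun _ _ _ => rfl
    simp only [htmul, map_mul, comulAt_fieldAt, Finset.sum_mul_sum]

theorem Omega_prod_fields (K : V ⊗[ℂ] V) {n : ℕ} (φ : Fin n → V) (e l v : ℕ) (hv : 0 < v)
    (h : e + 1 = l + v) :
    Omega K l v (∏ k, SymmetricAlgebra.ι ℂ V (φ k)) =
      ((e.factorial : ℂ) * 2 ^ e)⁻¹ • (contractSum e v (edge K) * ∏ k, ∑ j, fieldAt j (φ k)) := by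
  refine omegaRec_apply (M := TensorPow V) (fun v => edge K)
    (fun v => ∏ k, ∑ j, fieldAt j (φ k)) (fun v => comulAt) (fun _ _ _ => rfl) (fun _ _ _ => rfl)
    (fun v i a b => comulAt_edge K i a b)
    (fun v i => map_prod_sum_fields i (comulAt i) _ _ fun k j => comulAt_fieldAt i j (φ k))
    ?_ e l v hv h
  simp [fieldAt]

end Tensor

/-! ### The recursion on functions of the fields -/

section Completed

variable {W : Type*} [AddCommGroup W] {v : ℕ}

/-- Additivity replaces primitivity here; it is applied to the functionals `φ k` and to `B` in each
argument separately. -/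
theorem apply_mergeAt {A : Type*} [AddCommMonoid A] (g : W → A) (hg : ∀ x y, g (x + y) = g x + g y)
    (i j : Fin v) (f : Fin (v + 1) → W) :
    g (mergeAt i f j) = ∑ p with i.predAbove p = j, g (f p) := by
  rw [sum_filter_predAbove, mergeAt]
  split_ifs
  · rfl
  · exact hg _ _
  · rfl

variable [Module ℂ W]

/-- The coproduct `Δ_i` on functions of `v` fields as a homomorphism of algebras. -/
def comulAlgHomFunc (i : Fin v) : FieldFunc W v →ₐ[ℂ] FieldFunc W (v + 1) :=
  AlgHom.ofLinearMap (comulAtFunc i) rfl fun _ _ => rfl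

theorem OmegaFunc_prod_fields (B : LinearMap.BilinForm ℂ W) {n : ℕ} (φ : Fin n → Module.Dual ℂ W)
    (e l v : ℕ) (hv : 0 < v) (h : e + 1 = l + v) :
    OmegaFunc B l v (fun f => ∏ k, φ k f) =
      ((e.factorial : ℂ) * 2 ^ e)⁻¹ • (contractSum e v (edgeFunc B) *
        ∏ k, ∑ j, fun f : Fin v → W => φ k (f j)) := by
  refine omegaRec_apply (M := FieldFunc W) (fun v => edgeFunc B)
    (fun v => ∏ k, ∑ j, fun f : Fin v → W => φ k (f j)) (fun v => comulAlgHomFunc)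
    (fun _ _ _ => rfl) (fun _ _ _ => rfl) (fun v i a b => ?_)
    (fun v i => map_prod_sum_fields i (comulAlgHomFunc i) _ _ fun k j => ?_) ?_ e l v hv h
  · funext f
    change B (mergeAt i f a) (mergeAt i f b) = _
    rw [apply_mergeAt (fun x => B x (mergeAt i f b)) (by simp)]
    simp only [Finset.sum_apply, edgeFunc]
    refine Finset.sum_congr rfl fun p _ => ?_
    exact apply_mergeAt (fun x => B (f p) x) (by simp) i b f
  · funext f
    rw [Finset.sum_apply]
    exact apply_mergeAt (φ k) (map_add (φ k)) i j f
  · funext f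
    simp [LinearMap.funLeft_apply]

end Completed

/-! ### Connectedness and loop number in terms of the sequence of edges -/

namespace OrderedGraph

variable {v n : ℕ}

/-- The pair of vertices joined by each internal edge. -/
def edges (γ : OrderedGraph v n) : Fin γ.e → Fin v × Fin v :=
  fun k => (γ.att (k, false), γ.att (k, true))

theorem connected_iff_edgeConnected (γ : OrderedGraph v n) :
    γ.Connected ↔ EdgeConnected γ.edges := by
  constructor
  · intro h
    obtain ⟨x₀⟩ := h.nonempty
    refine ⟨x₀.pos, fun f hf x y => ?_⟩
    have hatt : ∀ p : Fin γ.e × Bool, f (γ.att p) ↔ f (γ.att (mate p)) := by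
      rintro ⟨k, _ | _⟩
      · exact hf k
      · exact (hf k).symm
    obtain ⟨p⟩ := h.preconnected x y
    induction p with
    | nil => rfl
    | cons hadj _ ih =>
      refine Iff.trans ?_ ih
      obtain ⟨-, ⟨p, rfl, rfl⟩ | ⟨p, rfl, rfl⟩⟩ := (SimpleGraph.fromRel_adj _ _ _).1 hadj
      · exact hatt p
      · exact (hatt p).symm
  · intro h
    have : Nonempty (Fin v) := ⟨⟨0, h.1⟩⟩
    -- Reachability from `x` is constant along edges; loops are treated apart because the simple
    -- graph omits them.
    refine ⟨fun x y => (h.2 (γ.toSimpleGraph.Reachable x) (fun k => ?_) x y).1 (.refl x)⟩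
    by_cases hk : (γ.edges k).1 = (γ.edges k).2
    · rw [hk]
    · have hadj : γ.toSimpleGraph.Adj (γ.edges k).1 (γ.edges k).2 :=
        (SimpleGraph.fromRel_adj _ _ _).2 ⟨hk, Or.inl ⟨(k, false), rfl, rfl⟩⟩
      exact ⟨fun hx => hx.trans hadj.reachable, fun hx => hx.trans hadj.symm.reachable⟩

theorem boundary_single (γ : OrderedGraph v n) (k : Fin γ.e) :
    γ.boundary (Pi.single k 1) = Pi.single (γ.edges k).2 1 - Pi.single (γ.edges k).1 1 := by
  rw [boundary, LinearMap.sum_apply, Finset.sum_eq_single k]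
  · simp [edges]
  · intro j _ hj
    simp [Pi.single_eq_of_ne hj]
  · simp

/-- In a connected graph, a chain of vertices is a boundary if and only if the sum of its
coefficients is zero. -/
theorem range_boundary {γ : OrderedGraph v n} (h : EdgeConnected γ.edges) :
    LinearMap.range γ.boundary = LinearMap.ker (∑ i : Fin v, LinearMap.proj (R := ℚ)
      (φ := fun _ : Fin v => ℚ) i) := by
  apply le_antisymm
  · rintro _ ⟨x, rfl⟩
    rw [LinearMap.mem_ker]
    simp [boundary]
  · intro y hy
    by_contra hny
    -- A functional vanishing on all boundaries takes the same value at every vertex, so it is a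
    -- multiple of the coefficient sum and cannot detect `y`.
    obtain ⟨f, hfy, hf⟩ := Submodule.exists_le_ker_of_notMem hny
    have hc : ∀ i j, f (Pi.single i 1) = f (Pi.single j 1) := h.apply_eq _ fun k => by
      have hk := hf (LinearMap.mem_range_self γ.boundary (Pi.single k 1))
      rw [LinearMap.mem_ker, boundary_single, map_sub, sub_eq_zero] at hk
      exact hk.symm
    apply hfy
    have hy' : ∑ i, y i = 0 := by simpa using hy
    rw [LinearMap.pi_apply_eq_sum_univ f y]
    have : ∀ i, f (fun j => if i = j then 1 else 0) = f (Pi.single ⟨0, h.1⟩ 1) := fun i => by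
      rw [← hc i]
      congr 1
      ext j
      simp [Pi.single_apply, eq_comm]
    simp_rw [this]
    rw [← Finset.sum_smul, hy', zero_smul]

/-- Euler's formula for connected graphs. -/
theorem loopNumber_add {γ : OrderedGraph v n} (h : EdgeConnected γ.edges) :
    γ.loopNumber + v = γ.e + 1 := by
  have h1 := LinearMap.finrank_range_add_finrank_ker γ.boundary
  rw [range_boundary h] at h1
  set S := ∑ i : Fin v, LinearMap.proj (R := ℚ) (φ := fun _ : Fin v => ℚ) i with hS
  have h2 := LinearMap.finrank_range_add_finrank_ker S
  have hsurj : LinearMap.range S = ⊤ := LinearMap.range_eq_top.2 fun c =>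
    ⟨Pi.single ⟨0, h.1⟩ c, by simp [hS]⟩
  rw [hsurj, finrank_top, Module.finrank_self, Module.finrank_fin_fun] at h2
  rw [Module.finrank_fin_fun] at h1
  rw [loopNumber]
  omega

/-! ### Counting isomorphisms -/

/-- The inverse of an isomorphism. -/
def Iso.symm {γ γ' : OrderedGraph v n} (f : Iso γ γ') : Iso γ' γ where
  vert := f.vert.symm
  ends := f.ends.symm
  ends_mate h := f.ends.injective (by simp [f.ends_mate])
  att_ends h := f.vert.injective (by simp [← f.att_ends])
  leg_eq k := f.vert.injective (by simp [← f.leg_eq])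

/-- The composition of isomorphisms. -/
def Iso.trans {γ γ' γ'' : OrderedGraph v n} (f : Iso γ γ') (g : Iso γ' γ'') : Iso γ γ'' where
  vert := f.vert.trans g.vert
  ends := f.ends.trans g.ends
  ends_mate h := by simp [f.ends_mate, g.ends_mate]
  att_ends h := by simp [f.att_ends, g.att_ends]
  leg_eq k := by simp [f.leg_eq, g.leg_eq]

/-- Composition with one isomorphism turns all of them into automorphisms. -/
theorem card_iso_eq_symmetryFactor {γ' γ : OrderedGraph v n} (f : Iso γ' γ) :
    Nat.card (Iso γ' γ) = γ.symmetryFactor :=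
  Nat.card_congr
    { toFun := fun g => f.symm.trans g
      invFun := fun g => f.trans g
      left_inv := fun g => by ext <;> simp [Iso.trans, Iso.symm]
      right_inv := fun g => by ext <;> simp [Iso.trans, Iso.symm] }

/-- The permutations of the ends of `e` internal edges which match ends of the same edge with ends
of the same edge. -/
abbrev EndsPerm (e : ℕ) : Type :=
  {π : Equiv.Perm (Fin e × Bool) // ∀ h, π (mate h) = mate (π h)}

theorem EndsPerm.apply_eq {e : ℕ} (π : EndsPerm e) (k : Fin e) (b : Bool) :
    π.1 (k, b) = ((π.1 (k, false)).1, xor b (π.1 (k, false)).2) := by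
  cases b
  · simp
  · rw [show ((k, true) : Fin e × Bool) = mate (k, false) from rfl, π.2]
    simp [mate]

/-- Such a permutation consists of a permutation of the edges and the choice of an orientation for
every edge. -/
def endsPermEquiv (e : ℕ) : EndsPerm e ≃ Equiv.Perm (Fin e) × (Fin e → Bool) where
  toFun π :=
    (Equiv.ofBijective (fun k => (π.1 (k, false)).1) <| Finite.injective_iff_bijective.1
      -- If the end `b` is the orientation bit itself, its image is the `false` end of the image
      -- edge, so equal image edges give equal images under `π`.
      fun k k' h => by
        have h1 := π.apply_eq k (π.1 (k, false)).2
        have h2 := π.apply_eq k' (π.1 (k', false)).2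
        simp only [Bool.xor_self] at h1 h2
        rw [show (π.1 (k, false)).1 = (π.1 (k', false)).1 from h, ← h2] at h1
        exact (Prod.ext_iff.1 (π.1.injective h1)).1,
      fun k => (π.1 (k, false)).2)
  invFun p := ⟨⟨fun h => (p.1 h.1, xor h.2 (p.2 h.1)),
      fun h => (p.1.symm h.1, xor h.2 (p.2 (p.1.symm h.1))),
      fun h => by simp, fun h => by simp⟩, fun h => by simp [mate]⟩
  left_inv π := by
    ext1
    ext1 ⟨k, b⟩
    exact (π.apply_eq k b).symm
  right_inv p := by
    refine Prod.ext (Equiv.ext fun k => ?_) (funext fun k => ?_) <;> simp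

open scoped Nat in
theorem card_endsPerm (e : ℕ) : Nat.card (EndsPerm e) = e ! * 2 ^ e := by
  rw [Nat.card_congr (endsPermEquiv e), Nat.card_prod, Nat.card_perm, Nat.card_fun]
  simp

/-- The ordered graph with a given sequence of internal edges and given external edges. -/
def ofEdges {e : ℕ} (x : (Fin e → Fin v × Fin v) × (Fin n → Fin v)) : OrderedGraph v n where
  e := e
  att h := cond h.2 (x.1 h.1).2 (x.1 h.1).1
  leg := x.2

theorem ofEdges_injective {e : ℕ} :
    Function.Injective (ofEdges : (Fin e → Fin v × Fin v) × (Fin n → Fin v) → _) := by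
  intro x y h
  obtain ⟨-, h1, h2⟩ := OrderedGraph.mk.inj h
  refine Prod.ext (funext fun k => ?_) h2
  have h1 := eq_of_heq h1
  exact Prod.ext (congrFun h1 (k, false)) (congrFun h1 (k, true))

/-- The edges of a graph after renumbering. -/
def renumber (γ : OrderedGraph v n) (p : Equiv.Perm (Fin v) × EndsPerm γ.e) :
    (Fin γ.e → Fin v × Fin v) × (Fin n → Fin v) :=
  (mapEnds p.1 fun k => (γ.att (p.2.1 (k, false)), γ.att (p.2.1 (k, true))),
    fun k => p.1 (γ.leg k))

/-- Isomorphisms to a graph `γ` are the same as renumberings of `γ`. -/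
def isoEquivRenumber (γ : OrderedGraph v n) (x : (Fin γ.e → Fin v × Fin v) × (Fin n → Fin v)) :
    Iso (ofEdges x) γ ≃ {p : Equiv.Perm (Fin v) × EndsPerm γ.e // γ.renumber p = x} where
  toFun f := ⟨(f.vert.symm, ⟨f.ends, f.ends_mate⟩), by
    refine Prod.ext (funext fun k => Prod.ext ?_ ?_) (funext fun k => ?_)
    · exact (Equiv.symm_apply_eq _).2 (f.att_ends (k, false))
    · exact (Equiv.symm_apply_eq _).2 (f.att_ends (k, true))
    · exact (Equiv.symm_apply_eq _).2 (f.leg_eq k)⟩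
  invFun p :=
    { vert := p.1.1.symm
      ends := p.1.2.1
      ends_mate := p.1.2.2
      att_ends := fun h => by
        obtain ⟨p, rfl⟩ := p
        obtain ⟨k, _ | _⟩ := h
        · exact (Equiv.symm_apply_apply _ _).symm
        · exact (Equiv.symm_apply_apply _ _).symm
      leg_eq := fun k => by
        obtain ⟨p, rfl⟩ := p
        exact (Equiv.symm_apply_apply _ _).symm }
  left_inv f := rfl
  right_inv p := rfl

/-- Constancy of a predicate along edges depends neither on their order nor on their orientation. -/
theorem edgeConnected_comp_endsPerm {γ : OrderedGraph v n} (h : EdgeConnected γ.edges)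
    (π : EndsPerm γ.e) :
    EdgeConnected fun k => (γ.att (π.1 (k, false)), γ.att (π.1 (k, true))) := by
  refine ⟨h.1, fun f hf => h.2 f fun k => ?_⟩
  have hatt : ∀ p : Fin γ.e × Bool, f (γ.att p) ↔ f (γ.att (mate p)) := fun p => by
    obtain ⟨⟨j, b⟩, rfl⟩ := π.1.surjective p
    rw [← π.2]
    cases b
    · exact hf j
    · exact (hf j).symm
  exact hatt (k, false)

open scoped Classical Nat in
/-- The orbit-stabilizer theorem for a connected graph, in terms of the renumberings for which the
edges contract consecutively. -/
theorem card_contracts_mul_symmetryFactor {γ : OrderedGraph v n} (h : EdgeConnected γ.edges) :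
    ((Finset.univ.filter (Contracts γ.e v) ×ˢ (Finset.univ : Finset (Fin n → Fin v))).filter
      fun x => Nonempty (Iso (ofEdges x) γ)).card * γ.symmetryFactor = γ.e ! * 2 ^ γ.e := by
  set T := (Finset.univ.filter (Contracts γ.e v) ×ˢ (Finset.univ : Finset (Fin n → Fin v))).filter
      fun x => Nonempty (Iso (ofEdges x) γ) with hT
  -- The contracting renumberings are counted twice: by the ordered graph they produce, with fibres
  -- of size `S^γ`, and by their action on the ends, which determines the vertex numbering uniquely.
  let P := Finset.univ.filter fun p : Equiv.Perm (Fin v) × EndsPerm γ.e =>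
    Contracts γ.e v (γ.renumber p).1
  have hPT : P.card = T.card * γ.symmetryFactor := by
    rw [Finset.card_eq_sum_card_fiberwise (f := γ.renumber) (t := T)]
    · refine Finset.sum_const_nat fun x hx => ?_
      obtain ⟨hx, ⟨f⟩⟩ := Finset.mem_filter.1 hx
      rw [← card_iso_eq_symmetryFactor f, Nat.card_congr (isoEquivRenumber γ x),
        Nat.card_eq_fintype_card, Fintype.card_subtype]
      congr 1
      ext p
      simp only [P, Finset.mem_filter, Finset.mem_univ, true_and, and_iff_right_iff_imp]
      rintro rfl
      exact (Finset.mem_filter.1 (Finset.mem_product.1 hx).1).2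
    · intro p hp
      have hp := (Finset.mem_filter.1 hp).2
      simp only [hT, Finset.coe_filter, Finset.mem_product, Finset.mem_filter, Finset.mem_univ,
        true_and, and_true, Set.mem_ofPred_eq]
      exact ⟨hp, ⟨(isoEquivRenumber γ _).symm ⟨p, rfl⟩⟩⟩
  rw [← hPT, ← card_endsPerm, Nat.card_eq_fintype_card, ← Finset.card_univ]
  refine Finset.card_bij (fun p _ => p.2) (fun _ _ => Finset.mem_univ _) ?_ ?_
  · rintro ⟨σ, π⟩ hp ⟨σ', π'⟩ hp' heq
    obtain rfl : π = π' := heq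
    have hσ : σ = σ' := (edgeConnected_comp_endsPerm h π).existsUnique_contracts.unique
      (Finset.mem_filter.1 hp).2 (Finset.mem_filter.1 hp').2
    rw [hσ]
  · intro π _
    obtain ⟨σ, hσ⟩ := (edgeConnected_comp_endsPerm h π).existsUnique_contracts.exists
    exact ⟨(σ, π), Finset.mem_filter.2 ⟨Finset.mem_univ _, hσ⟩, rfl⟩

end OrderedGraph

/-! ### The weights -/

open scoped Classical in
/-- The ordered graphs with `e` internal edges which contract consecutively. -/
def contractGraphs (e v n : ℕ) : Finset (OrderedGraph v n) :=
  (Finset.univ.filter (Contracts e v) ×ˢ (Finset.univ : Finset (Fin n → Fin v))).map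
    ⟨OrderedGraph.ofEdges, OrderedGraph.ofEdges_injective⟩

/-- The weights of the ordered graphs: graphs with `e` internal edges which contract consecutively
have the weight `1 / (e! 2 ^ e)`. -/
def omegaWeight (e v n : ℕ) : OrderedGraph v n →₀ ℚ :=
  Finsupp.indicator (contractGraphs e v n) fun _ _ => ((e.factorial : ℚ) * 2 ^ e)⁻¹

theorem omegaWeight_of_mem {e v n : ℕ} {γ : OrderedGraph v n} (hγ : γ ∈ contractGraphs e v n) :
    omegaWeight e v n γ = ((e.factorial : ℚ) * 2 ^ e)⁻¹ :=
  Finsupp.indicator_of_mem hγ _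

theorem support_omegaWeight (e v n : ℕ) :
    (omegaWeight e v n).support = contractGraphs e v n := by
  ext γ
  rw [Finsupp.mem_support_iff]
  by_cases hγ : γ ∈ contractGraphs e v n
  · rw [omegaWeight_of_mem hγ]
    simp [hγ, Nat.factorial_ne_zero]
  · simp [omegaWeight, Finsupp.indicator_of_notMem hγ, hγ]

theorem omegaWeight_connected {e v n : ℕ} {γ : OrderedGraph v n}
    (hγ : γ ∈ (omegaWeight e v n).support) : γ.Connected ∧ γ.loopNumber + v = e + 1 := by
  classical
  rw [support_omegaWeight, contractGraphs, Finset.mem_map] at hγ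
  obtain ⟨x, hx, rfl⟩ := hγ
  have h : EdgeConnected (OrderedGraph.ofEdges x).edges :=
    Contracts.edgeConnected (Finset.mem_filter.1 (Finset.mem_product.1 hx).1).2
  exact ⟨(OrderedGraph.connected_iff_edgeConnected _).2 h, OrderedGraph.loopNumber_add h⟩

theorem unorderedWeight_omegaWeight {v n : ℕ} {γ : OrderedGraph v n} (h : γ.Connected) :
    OrderedGraph.unorderedWeight (omegaWeight γ.e v n) γ = 1 / (γ.symmetryFactor : ℚ) := by
  classical
  have key := OrderedGraph.card_contracts_mul_symmetryFactor
    ((OrderedGraph.connected_iff_edgeConnected γ).1 h)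
  rw [OrderedGraph.unorderedWeight, support_omegaWeight,
    Finset.sum_congr rfl fun γ' hγ' => omegaWeight_of_mem (Finset.mem_filter.1 hγ').1,
    Finset.sum_const, contractGraphs, Finset.filter_map, Finset.card_map, nsmul_eq_mul]
  have hne : γ.e.factorial * 2 ^ γ.e ≠ 0 := by positivity
  -- The count excludes the value `0` of the symmetry factor, since its right side is nonzero.
  have hS : (γ.symmetryFactor : ℚ) ≠ 0 := by
    intro h0
    rw [Nat.cast_eq_zero] at h0
    rw [h0, mul_zero] at key
    exact hne key.symm
  have key' := congrArg (Nat.cast : ℕ → ℚ) key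
  push_cast at key'
  rw [eq_div_iff hS, mul_right_comm]
  exact (congrArg (· * _) key').trans (mul_inv_cancel₀ (by exact_mod_cast hne))

/-- Expanding the product of sums over positions chooses a vertex for every external edge, so the
terms are exactly the ordered graphs in the support. -/
theorem sum_omegaWeight {A : Type*} [CommRing A] [Algebra ℂ A] {v n : ℕ} (e : ℕ)
    (R : Fin v → Fin v → A) (x : Fin n → Fin v → A) (g : OrderedGraph v n → A)
    (hg : ∀ γ, g γ = (∏ k : Fin γ.e, R (γ.att (k, false)) (γ.att (k, true))) *
      ∏ k, x k (γ.leg k)) :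
    ((omegaWeight e v n).sum fun γ c => (c : ℂ) • g γ) =
      ((e.factorial : ℂ) * 2 ^ e)⁻¹ • (contractSum e v R * ∏ k, ∑ j, x k j) := by
  classical
  rw [Finsupp.sum, support_omegaWeight,
    Finset.sum_congr rfl fun γ hγ => by rw [omegaWeight_of_mem hγ], ← Finset.smul_sum,
    contractGraphs, Finset.sum_map, Finset.sum_product, Finset.prod_univ_sum,
    Fintype.piFinset_univ, contractSum, Finset.sum_mul_sum]
  push_cast
  refine congrArg _ (Finset.sum_congr ?_ fun s _ => Finset.sum_congr rfl fun y _ => hg _)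
  ext s
  simp

end Feynman
end

theorem theorem1 (l v n : ℕ) (hv : 1 ≤ v) :
    ∃ w : Feynman.OrderedGraph v n →₀ ℚ,
      (∀ γ ∈ w.support, γ.Connected ∧ γ.loopNumber = l) ∧
      (∀ γ : Feynman.OrderedGraph v n, γ.Connected → γ.loopNumber = l →
        Feynman.OrderedGraph.unorderedWeight w γ = 1 / (γ.symmetryFactor : ℚ)) ∧
      (∀ (V : Type*) [AddCommGroup V] [Module ℂ V] (K : TensorProduct ℂ V V),
        TensorProduct.comm ℂ V V K = K →
        ∀ φ : Fin n → V,
          Feynman.Omega K l v (∏ k : Fin n, SymmetricAlgebra.ι ℂ V (φ k)) =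
            w.sum fun γ c => (c : ℂ) • Feynman.graphElement K φ γ) ∧
      (∀ (W : Type*) [AddCommGroup W] [Module ℂ W] (B : LinearMap.BilinForm ℂ W),
        (∀ f g : W, B f g = B g f) →
        ∀ φ : Fin n → Module.Dual ℂ W,
          Feynman.OmegaFunc B l v (fun f => ∏ k : Fin n, φ k f) =
            w.sum fun γ c => (c : ℂ) • Feynman.graphFunc B φ γ) := by
  obtain ⟨e, he⟩ : ∃ e, e + 1 = l + v := ⟨l + v - 1, by omega⟩
  refine ⟨Feynman.omegaWeight e v n, fun γ hγ => ?_, fun γ hγ hl => ?_, ?_, ?_⟩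
  · obtain ⟨h, hl⟩ := Feynman.omegaWeight_connected hγ
    exact ⟨h, by omega⟩
  · have h := Feynman.OrderedGraph.loopNumber_add
      ((Feynman.OrderedGraph.connected_iff_edgeConnected γ).1 hγ)
    -- By Euler's formula the loop number fixes the number of internal edges, so the weights are
    -- those for `γ.e` edges.
    obtain rfl : e = γ.e := by omega
    exact Feynman.unorderedWeight_omegaWeight hγ
  · intro V _ _ K _ φ
    rw [Feynman.Omega_prod_fields K φ e l v hv he]
    exact (Feynman.sum_omegaWeight e (Feynman.edge K) (fun k j => Feynman.fieldAt j (φ k)) _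
      fun γ => rfl).symm
  · intro W _ _ B _ φ
    rw [Feynman.OmegaFunc_prod_fields B φ e l v hv he]
    refine (Feynman.sum_omegaWeight e (Feynman.edgeFunc B)
      (fun k j (f : Fin v → W) => φ k (f j)) _ fun γ => ?_).symm
    funext f
    simp [Feynman.graphFunc, Feynman.edgeFunc]
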